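/- Let $\mu$ be a nonnegative Borel measure on $\mathbb{R}$ (a measure given on a bounded or unbounded interval $\mathcal{D}$ is extended by zero) whose support is infinite and all of whose moments $\int x^n\,d\mu(x)$, $n\ge 0$, are finite. Write $\langle f,g\rangle_\mu=\int fg\,d\mu$, let $p_k$ ($k\ge 0$) be the monic polynomial of degree $k$ with $\langle x^j,p_k\rangle_\mu=0$ for $0\le j<k$, and put $$\alpha_k=\frac{\langle xp_k,p_k\rangle_\mu}{\langle p_k,p_k\rangle_\mu}\ (k\ge 0),\qquad \beta_0=\langle p_0,p_0\rangle_\mu,\qquad \beta_k=\frac{\langle p_k,p_k\rangle_\mu}{\langle p_{k-1},p_{k-1}\rangle_\mu}\ (k\ge 1).$$ For an integer $m\ge 0$ let $J^*_{m+1}$ be the real symmetric tridiagonal matrix of order $m+1$ with diagonal entries $\alpha_0,\dots,\alpha_m$ and off-diagonal entries $\sqrt{\beta_1},\dots,\sqrt{\beta_{m-1}},\sqrt{\beta_m+\beta_{m+1}}$ (for $m=0$, $J^*_1=[\alpha_0]$). Let $x^*_1<\dots<x^*_{m+1}$ be its eigenvalues and let $\lambda^*_k=\beta_0v_{k,1}^2$,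 where $v_{k,1}$ is the first component of a normalized real eigenvector of $J^*_{m+1}$ for $x^*_k$; these are the nodes and weights of the quadrature rule $G^*_{m+1}(f)=\sum_{k=1}^{m+1}\lambda^*_kf(x^*_k)$. **Lemma 2.1 (Markov–Stieltjes inequality).** For every $k\in\{1,\dots,m+1\}$, $$\sum_{i=1}^{k-1}\lambda^*_i\ \le\ \int_{(-\infty,x^*_k]}d\mu(x)\ \le\ \sum_{i=1}^{k}\lambda^*_i .$$ -/

import Mathlib

namespace AveragedGauss

open Polynomial MeasureTheory

/-- The bilinear form `⟨p, q⟩_μ = ∫ p(x) q(x) dμ(x)` on real polynomials. -/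
noncomputable def ip (μ : Measure ℝ) (p q : ℝ[X]) : ℝ :=
  ∫ x, p.eval x * q.eval x ∂μ

/-- The monic orthogonal polynomials `p_k` of `μ`, obtained from `1, X, X ^ 2, …` by the
(unnormalized) Gram-Schmidt process. For a measure with finite moments and infinite support, `p_k`
is the monic polynomial of degree `k` that is orthogonal to `1, X, …, X ^ (k - 1)`; this is
proved in `orthoPoly_monic`, `natDegree_orthoPoly` and `ip_X_pow_orthoPoly` below. -/
noncomputable def orthoPoly (μ : Measure ℝ) (k : ℕ) : ℝ[X] :=
  X ^ k - ∑ j : Fin k,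
    C (ip μ (X ^ k) (orthoPoly μ j) / ip μ (orthoPoly μ j) (orthoPoly μ j)) * orthoPoly μ j
termination_by k
decreasing_by all_goals exact j.isLt

/-- The recursion coefficient `α_k = ⟨x p_k, p_k⟩ / ⟨p_k, p_k⟩`. -/
noncomputable def alpha (μ : Measure ℝ) (k : ℕ) : ℝ :=
  ip μ (X * orthoPoly μ k) (orthoPoly μ k) / ip μ (orthoPoly μ k) (orthoPoly μ k)

/-- The recursion coefficients `β_0 = ⟨p_0, p_0⟩` and `β_k = ⟨p_k, p_k⟩ / ⟨p_{k-1}, p_{k-1}⟩`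
for `k ≥ 1`. -/
noncomputable def beta (μ : Measure ℝ) : ℕ → ℝ
  | 0 => ip μ (orthoPoly μ 0) (orthoPoly μ 0)
  | k + 1 => ip μ (orthoPoly μ (k + 1)) (orthoPoly μ (k + 1)) / ip μ (orthoPoly μ k) (orthoPoly μ k)

/-- The off-diagonal entry of `J*_{m+1}` in the (zero-based) positions `(i, i + 1)` and
`(i + 1, i)`: it is `√β_{i+1}` inside the leading block `J_m`, and `√(β_m + β_{m+1})` in the last
row and column. -/
noncomputable def offDiag (μ : Measure ℝ) (m i : ℕ) : ℝ :=
  if i + 1 = m then √(beta μ m + beta μ (m + 1)) else √(beta μ (i + 1))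

/-- The symmetric tridiagonal matrix `J*_{m+1}` of order `m + 1`. -/
noncomputable def JStar (μ : Measure ℝ) (m : ℕ) : Matrix (Fin (m + 1)) (Fin (m + 1)) ℝ :=
  Matrix.of fun i j =>
    if i = j then alpha μ i
    else if (i : ℕ) + 1 = j then offDiag μ m i
    else if (j : ℕ) + 1 = i then offDiag μ m j
    else 0

theorem JStar_isHermitian (μ : Measure ℝ) (m : ℕ) : (JStar μ m).IsHermitian := by
  ext i j
  simp only [JStar, Matrix.conjTranspose_apply, Matrix.of_apply, star_trivial]
  by_cases h : i = j
  · subst h; rfl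
  · have h' : j ≠ i := fun e => h e.symm
    simp only [h, h', if_false]
    by_cases h1 : (i : ℕ) + 1 = j
    · have h2 : ¬ ((j : ℕ) + 1 = i) := by omega
      simp [h1, h2]
    · simp [h1]

/-- The permutation that lists the eigenvalues of `J*_{m+1}` in increasing order. -/
noncomputable def order (μ : Measure ℝ) (m : ℕ) : Equiv.Perm (Fin (m + 1)) :=
  Tuple.sort (JStar_isHermitian μ m).eigenvalues

/-- The nodes `x*_1 < ⋯ < x*_{m+1}` of `G*_{m+1}` (indexed from `0`): the eigenvalues of
`J*_{m+1}` in increasing order. -/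
noncomputable def node (μ : Measure ℝ) (m : ℕ) (k : Fin (m + 1)) : ℝ :=
  (JStar_isHermitian μ m).eigenvalues (order μ m k)

/-- The weights of `G*_{m+1}`: `λ*_k = β_0 v_{k,1} ^ 2`, where `v_{k,1}` is the first component of
a normalized real eigenvector of `J*_{m+1}` for the eigenvalue `x*_k`. -/
noncomputable def weight (μ : Measure ℝ) (m : ℕ) (k : Fin (m + 1)) : ℝ :=
  beta μ 0 * ((JStar_isHermitian μ m).eigenvectorBasis (order μ m k) 0) ^ 2

/-! The polynomials `orthoPoly μ k` are the monic orthogonal polynomials of `μ`. -/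

theorem natDegree_orthoPoly_aux (μ : Measure ℝ) (k : ℕ) :
    (orthoPoly μ k).Monic ∧ (orthoPoly μ k).natDegree = k := by
  induction k using Nat.strong_induction_on with
  | _ k ih =>
    have hlt : (∑ j : Fin k,
        C (ip μ (X ^ k) (orthoPoly μ j) / ip μ (orthoPoly μ j) (orthoPoly μ j)) *
          orthoPoly μ j).degree < ((X : ℝ[X]) ^ k).degree := by
      rw [degree_X_pow]
      refine (degree_sum_le _ _).trans_lt ?_
      rw [Finset.sup_lt_iff (by exact WithBot.bot_lt_coe k)]
      intro j _
      rw [← smul_eq_C_mul]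
      refine (degree_smul_le _ _).trans_lt ?_
      refine degree_le_natDegree.trans_lt ?_
      rw [(ih j j.isLt).2]
      exact_mod_cast j.isLt
    rw [orthoPoly]
    have hm := (monic_X_pow (R := ℝ) k).sub_of_left hlt
    refine ⟨hm, ?_⟩
    rw [natDegree_eq_of_degree_eq (degree_sub_eq_left_of_degree_lt hlt), natDegree_X_pow]

theorem orthoPoly_monic (μ : Measure ℝ) (k : ℕ) : (orthoPoly μ k).Monic :=
  (natDegree_orthoPoly_aux μ k).1

theorem natDegree_orthoPoly (μ : Measure ℝ) (k : ℕ) : (orthoPoly μ k).natDegree = k :=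
  (natDegree_orthoPoly_aux μ k).2

theorem integrable_eval {μ : Measure ℝ} (hmom : ∀ n : ℕ, Integrable (fun x : ℝ => x ^ n) μ)
    (p : ℝ[X]) : Integrable (fun x => p.eval x) μ := by
  simp only [eval_eq_sum_range]
  exact integrable_finsetSum _ fun i _ => (hmom i).const_mul _

theorem integrable_eval_mul {μ : Measure ℝ} (hmom : ∀ n : ℕ, Integrable (fun x : ℝ => x ^ n) μ)
    (p q : ℝ[X]) : Integrable (fun x => p.eval x * q.eval x) μ := by
  simpa using integrable_eval hmom (p * q)

theorem ip_comm (μ : Measure ℝ) (p q : ℝ[X]) : ip μ p q = ip μ q p := by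
  simp only [ip, mul_comm]

theorem ip_sub_right {μ : Measure ℝ} (hmom : ∀ n : ℕ, Integrable (fun x : ℝ => x ^ n) μ)
    (p q r : ℝ[X]) : ip μ p (q - r) = ip μ p q - ip μ p r := by
  simp only [ip, eval_sub, mul_sub]
  exact integral_sub (integrable_eval_mul hmom _ _) (integrable_eval_mul hmom _ _)

theorem ip_add_right {μ : Measure ℝ} (hmom : ∀ n : ℕ, Integrable (fun x : ℝ => x ^ n) μ)
    (p q r : ℝ[X]) : ip μ p (q + r) = ip μ p q + ip μ p r := by
  simp only [ip, eval_add, mul_add]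
  exact integral_add (integrable_eval_mul hmom _ _) (integrable_eval_mul hmom _ _)

theorem ip_sum_C_mul_right {μ : Measure ℝ}
    (hmom : ∀ n : ℕ, Integrable (fun x : ℝ => x ^ n) μ) {ι : Type*} (s : Finset ι)
    (p : ℝ[X]) (c : ι → ℝ) (q : ι → ℝ[X]) :
    ip μ p (∑ j ∈ s, C (c j) * q j) = ∑ j ∈ s, c j * ip μ p (q j) := by
  simp only [ip, eval_finsetSum, eval_mul, eval_C, Finset.mul_sum]
  rw [integral_finsetSum]
  · refine Finset.sum_congr rfl fun j _ => ?_
    rw [← integral_const_mul]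
    exact integral_congr_ae (.of_forall fun x => by ring)
  · intro j _
    have := (integrable_eval_mul hmom p (q j)).const_mul (c j)
    exact this.congr (.of_forall fun x => by simp only; ring)

theorem ip_self_ne_zero {μ : Measure ℝ} (hmom : ∀ n : ℕ, Integrable (fun x : ℝ => x ^ n) μ)
    (hsupp : μ.support.Infinite) {p : ℝ[X]} (hp : p ≠ 0) : ip μ p p ≠ 0 := by
  intro h
  have h0 := (integral_eq_zero_iff_of_nonneg (fun x => mul_self_nonneg (p.eval x))
    (integrable_eval_mul hmom p p)).1 h
  refine hsupp ((p.roots.toFinset.finite_toSet).subset ?_)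
  have hclosed : IsClosed (p.roots.toFinset : Set ℝ) := (p.roots.toFinset.finite_toSet).isClosed
  refine Measure.support_subset_of_isClosed hclosed ?_
  filter_upwards [h0] with x hx
  simp only [Pi.zero_apply, mul_self_eq_zero] at hx
  simpa [hp] using hx

theorem ip_orthoPoly_of_lt {μ : Measure ℝ}
    (hmom : ∀ n : ℕ, Integrable (fun x : ℝ => x ^ n) μ) (hsupp : μ.support.Infinite) (k : ℕ) :
    ∀ i < k, ip μ (orthoPoly μ i) (orthoPoly μ k) = 0 := by
  induction k using Nat.strong_induction_on with
  | _ k ih =>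
    intro i hi
    rw [orthoPoly.eq_1 μ k, ip_sub_right hmom, ip_sum_C_mul_right hmom,
      Finset.sum_eq_single (⟨i, hi⟩ : Fin k)]
    · have := ip_self_ne_zero hmom hsupp (orthoPoly_monic μ i).ne_zero
      simp only
      rw [div_mul_cancel₀ _ this, ip_comm μ _ (X ^ k), sub_self]
    · intro j _ hj
      have hne : (j : ℕ) ≠ i := fun e => hj (Fin.ext e)
      rcases lt_or_gt_of_ne hne with h | h
      · rw [ip_comm μ (orthoPoly μ i), ih i hi j h, mul_zero]
      · rw [ih j j.isLt i h, mul_zero]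
    · simp

/-- Orthogonality: `∫ x ^ j p_k(x) dμ(x) = 0` for `j < k`. -/
theorem ip_X_pow_orthoPoly {μ : Measure ℝ}
    (hmom : ∀ n : ℕ, Integrable (fun x : ℝ => x ^ n) μ) (hsupp : μ.support.Infinite)
    {j k : ℕ} (hjk : j < k) : ip μ (X ^ j) (orthoPoly μ k) = 0 := by
  have h := sub_eq_iff_eq_add.1 (orthoPoly.eq_1 μ j).symm
  rw [h, ip_comm, ip_add_right hmom, ip_sum_C_mul_right hmom, ip_comm,
    ip_orthoPoly_of_lt hmom hsupp k j hjk, zero_add]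
  refine Finset.sum_eq_zero fun i _ => ?_
  rw [ip_comm μ (orthoPoly μ k), ip_orthoPoly_of_lt hmom hsupp k i (i.isLt.trans hjk), mul_zero]

end AveragedGauss

namespace AveragedGauss

open Polynomial MeasureTheory

/-- Functions built from nonnegative constants and the functions `x ↦ (c - x)⁻¹` with `b < c` by
sums and products; they are absolutely monotone on `(-∞, b]`. -/
inductive ReciprocalClass (b : ℝ) : (ℝ → ℝ) → Prop
  | const (c : ℝ) (hc : 0 ≤ c) : ReciprocalClass b fun _ => c
  | inv (c : ℝ) (hc : b < c) : ReciprocalClass b fun x => (c - x)⁻¹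
  | add {f g : ℝ → ℝ} (hf : ReciprocalClass b f) (hg : ReciprocalClass b g) :
      ReciprocalClass b fun x => f x + g x
  | mul {f g : ℝ → ℝ} (hf : ReciprocalClass b f) (hg : ReciprocalClass b g) :
      ReciprocalClass b fun x => f x * g x

theorem ReciprocalClass.nonneg {b : ℝ} {f : ℝ → ℝ} (hf : ReciprocalClass b f) {x : ℝ}
    (hx : x ≤ b) : 0 ≤ f x := by
  induction hf with
  | const c hc => exact hc
  | inv c hc => exact inv_nonneg.2 (by linarith)
  | add _ _ h₁ h₂ => exact add_nonneg h₁ h₂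
  | mul _ _ h₁ h₂ => exact mul_nonneg h₁ h₂

theorem ReciprocalClass.exists_slope {b : ℝ} {f : ℝ → ℝ} (hf : ReciprocalClass b f) {a : ℝ}
    (ha : a ≤ b) :
    ∃ g, ReciprocalClass b g ∧ ∀ x ≤ b, f x = f a + (x - a) * g x := by
  induction hf with
  | const c hc => exact ⟨_, .const 0 le_rfl, fun x _ => by simp⟩
  | inv c hc =>
    refine ⟨_, .mul (.const (c - a)⁻¹ (inv_nonneg.2 (by linarith))) (.inv c hc),
      fun x hx => ?_⟩
    have h₁ : c - a ≠ 0 := by linarith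
    have h₂ : c - x ≠ 0 := by linarith
    field_simp
    ring
  | add _ _ h₁ h₂ =>
    obtain ⟨u, hu, hu'⟩ := h₁
    obtain ⟨v, hv, hv'⟩ := h₂
    exact ⟨_, .add hu hv, fun x hx => by
      simp only; linear_combination hu' x hx + hv' x hx⟩
  | @mul f g hf hg h₁ h₂ =>
    obtain ⟨u, hu, hu'⟩ := h₁
    obtain ⟨v, hv, hv'⟩ := h₂
    exact ⟨_, .add (.mul hu hg) (.mul (.const (f a) (hf.nonneg ha)) hv), fun x hx => by
      simp only; linear_combination g x * hu' x hx + f a * hv' x hx⟩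

/-- Newton interpolation of a function in `ReciprocalClass b` at points `≤ b`. -/
theorem ReciprocalClass.exists_interpolation {b : ℝ} (l : List ℝ) (hl : ∀ a ∈ l, a ≤ b)
    {f : ℝ → ℝ} (hf : ReciprocalClass b f) :
    ∃ (q : ℝ[X]) (g : ℝ → ℝ), ReciprocalClass b g ∧ q.natDegree ≤ l.length - 1 ∧
      (∀ x, b ≤ x → 0 ≤ q.eval x) ∧
      ∀ x ≤ b, f x = q.eval x + (l.map fun a => x - a).prod * g x := by
  induction l generalizing f with
  | nil => exact ⟨0, f, hf, by simp, by simp, by simp⟩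
  | cons a l ih =>
    have ha : a ≤ b := hl a (by simp)
    obtain ⟨u, hu, hu'⟩ := hf.exists_slope ha
    rcases l.eq_nil_or_concat with rfl | hne
    · exact ⟨C (f a), u, hu, by simp, fun x _ => by simpa using hf.nonneg ha,
        fun x hx => by simpa using hu' x hx⟩
    · have hpos : 1 ≤ l.length := by
        obtain ⟨_, _, rfl⟩ := hne
        simp
      obtain ⟨q, g, hg, hq, hq0, hfg⟩ := ih (fun c hc => hl c (by simp [hc])) hu
      refine ⟨C (f a) + (X - C a) * q, g, hg, ?_, fun x hx => ?_, fun x hx => ?_⟩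
      · refine (natDegree_add_le _ _).trans (max_le (by simp) ?_)
        refine natDegree_mul_le.trans ?_
        rw [natDegree_X_sub_C, List.length_cons]
        omega
      · have := mul_nonneg (sub_nonneg.2 (ha.trans hx)) (hq0 x hx)
        have := hf.nonneg ha
        simp only [eval_add, eval_C, eval_mul, eval_sub, eval_X]
        linarith
      · simp only [eval_add, eval_C, eval_mul, eval_sub, eval_X, List.map_cons, List.prod_cons]
        linear_combination hu' x hx + (x - a) * hfg x hx

theorem ReciprocalClass.prod_inv_sq {b : ℝ} (s : Finset ℝ) (hs : ∀ c ∈ s, b < c) :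
    ReciprocalClass b fun x => ∏ c ∈ s, ((c - x)⁻¹ * (c - x)⁻¹) := by
  induction s using Finset.induction_on with
  | empty => simpa using ReciprocalClass.const (b := b) 1 zero_le_one
  | insert c s hc ih =>
    simp only [Finset.prod_insert hc]
    have h := hs c (by simp)
    exact .mul (.mul (.inv c h) (.inv c h)) (ih fun d hd => hs d (by simp [hd]))

/-- A polynomial majorant of the indicator function of `(-∞, b]` that agrees with it at
prescribed points. -/
theorem exists_majorant {b : ℝ} (s t : Finset ℝ) (hs : ∀ c ∈ s, c < b) (ht : ∀ c ∈ t, b < c) :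
    ∃ f : ℝ[X], f.natDegree ≤ 2 * (s.card + t.card) ∧ (∀ x, 0 ≤ f.eval x) ∧
      (∀ x ≤ b, 1 ≤ f.eval x) ∧ (∀ c ∈ s, f.eval c = 1) ∧ f.eval b = 1 ∧
      ∀ c ∈ t, f.eval c = 0 := by
  have hl : ∀ a ∈ b :: (s.toList ++ s.toList), a ≤ b := by
    intro a ha
    simp only [List.mem_cons, List.mem_append, Finset.mem_toList, or_self] at ha
    rcases ha with rfl | ha
    · exact le_rfl
    · exact (hs a ha).le
  obtain ⟨q, g, hg, hq, hq0, hfg⟩ :=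
    ReciprocalClass.exists_interpolation _ hl (ReciprocalClass.prod_inv_sq t ht)
  simp only [List.map_cons, List.map_append, List.prod_cons, List.prod_append,
    Finset.prod_map_toList, ← sq] at hfg
  have key : ∀ x ≤ b, (∏ c ∈ t, (x - c) ^ 2) * q.eval x =
      1 + (∏ c ∈ t, (x - c) ^ 2) * ((b - x) * (∏ c ∈ s, (x - c)) ^ 2 * g x) := by
    intro x hx
    have h1 : (∏ c ∈ t, (x - c) ^ 2) * ∏ c ∈ t, (c - x)⁻¹ ^ 2 = 1 := by
      rw [← Finset.prod_mul_distrib]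
      refine Finset.prod_eq_one fun c hc => ?_
      have : c - x ≠ 0 := by linarith [ht c hc]
      field_simp
      ring
    linear_combination h1 - (∏ c ∈ t, (x - c) ^ 2) * hfg x hx
  have hnn : ∀ x, 0 ≤ ∏ c ∈ t, (x - c) ^ 2 := fun x => Finset.prod_nonneg fun c _ => sq_nonneg _
  have hev : ∀ x, ((∏ c ∈ t, (X - C c) ^ 2) * q).eval x = (∏ c ∈ t, (x - c) ^ 2) * q.eval x := by
    intro x
    simp [eval_prod]
  have hge : ∀ x ≤ b, 1 ≤ ((∏ c ∈ t, (X - C c) ^ 2) * q).eval x := by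
    intro x hx
    rw [hev, key x hx, le_add_iff_nonneg_right]
    exact mul_nonneg (hnn x) (mul_nonneg (mul_nonneg (by linarith) (sq_nonneg _)) (hg.nonneg hx))
  refine ⟨(∏ c ∈ t, (X - C c) ^ 2) * q, ?_, fun x => ?_, hge, fun c hc => ?_, ?_, fun c hc => ?_⟩
  · refine natDegree_mul_le.trans ?_
    have h1 : (∏ c ∈ t, (X - C c) ^ 2 : ℝ[X]).natDegree ≤ 2 * t.card := by
      refine (natDegree_prod_le _ _).trans ?_
      simp [mul_comm]
    simp only [List.length_cons, List.length_append, Finset.length_toList] at hq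
    omega
  · rcases le_total x b with hx | hx
    · exact zero_le_one.trans (hge x hx)
    · rw [hev]
      exact mul_nonneg (hnn x) (hq0 x hx)
  · rw [hev, key c (hs c hc).le, Finset.prod_eq_zero hc (sub_self c)]
    simp
  · rw [hev, key b le_rfl]
    simp
  · rw [hev, Finset.prod_eq_zero hc (by simp)]
    simp

theorem linearMap_eq_zero_of_monic {L : ℝ[X] →ₗ[ℝ] ℝ} {e : ℕ → ℝ[X]} (he : ∀ d, (e d).Monic)
    (hd : ∀ d, (e d).natDegree = d) {n : ℕ} (hL : ∀ d < n, L (e d) = 0) {f : ℝ[X]}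
    (hf : f.degree < n) : L f = 0 := by
  induction n generalizing f with
  | zero =>
    have : f = 0 := by simpa using hf
    simp [this]
  | succ n ih =>
    have hdeg : (e n).degree = n := by
      rw [degree_eq_natDegree (he n).ne_zero, hd]
    have h : (f - f.coeff n • e n).degree < n := by
      rw [degree_lt_iff_coeff_zero]
      intro i hi
      rcases hi.eq_or_lt with rfl | hi
      · have : (e n).coeff n = 1 := by
          have := (he n).coeff_natDegree
          rwa [hd] at this
        simp [this]
      · have h1 : f.coeff i = 0 := (degree_lt_iff_coeff_zero f (n + 1)).1 hf i hi
        have h2 : (e n).coeff i = 0 := coeff_eq_zero_of_natDegree_lt (by rwa [hd])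
        simp [h1, h2]
    have h0 := ih (fun d hd => hL d (by omega)) h
    rw [map_sub, map_smul, hL n (by omega), smul_zero, sub_zero] at h0
    exact h0

/-- Integration of polynomials as a linear functional. -/
noncomputable def integralMap {μ : Measure ℝ}
    (hmom : ∀ n : ℕ, Integrable (fun x : ℝ => x ^ n) μ) : ℝ[X] →ₗ[ℝ] ℝ where
  toFun f := ∫ x, f.eval x ∂μ
  map_add' f g := by
    simp only [eval_add]
    exact integral_add (integrable_eval hmom f) (integrable_eval hmom g)
  map_smul' c f := by
    simp only [eval_smul, smul_eq_mul, RingHom.id_apply]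
    exact integral_const_mul _ _

variable {μ : Measure ℝ}

theorem ip_eq_integralMap (hmom : ∀ n : ℕ, Integrable (fun x : ℝ => x ^ n) μ) (p q : ℝ[X]) :
    ip μ p q = integralMap hmom (p * q) := by
  simp [ip, integralMap]

theorem ip_orthoPoly_of_degree_lt (hmom : ∀ n : ℕ, Integrable (fun x : ℝ => x ^ n) μ)
    (hsupp : μ.support.Infinite) {k : ℕ} {f : ℝ[X]} (hf : f.degree < k) :
    ip μ (orthoPoly μ k) f = 0 := by
  have := linearMap_eq_zero_of_monic
    (L := integralMap hmom ∘ₗ LinearMap.mulLeft ℝ (orthoPoly μ k))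
    (orthoPoly_monic μ) (natDegree_orthoPoly μ) (n := k) (fun d hd => by
      have := ip_orthoPoly_of_lt hmom hsupp k d hd
      rw [ip_comm, ip_eq_integralMap hmom] at this
      simpa using this) hf
  rw [ip_eq_integralMap hmom]
  simpa using this

theorem degree_orthoPoly (μ : Measure ℝ) (k : ℕ) : (orthoPoly μ k).degree = k := by
  rw [degree_eq_natDegree (orthoPoly_monic μ k).ne_zero, natDegree_orthoPoly]

theorem ip_orthoPoly_of_monic (hmom : ∀ n : ℕ, Integrable (fun x : ℝ => x ^ n) μ)
    (hsupp : μ.support.Infinite) {k : ℕ} {f : ℝ[X]} (hf : f.Monic) (hdeg : f.degree = k) :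
    ip μ (orthoPoly μ k) f = ip μ (orthoPoly μ k) (orthoPoly μ k) := by
  have h : (f - orthoPoly μ k).degree < k := by
    rw [← hdeg]
    exact degree_sub_lt_left (by rw [hdeg, degree_orthoPoly]) hf.ne_zero
      (by rw [hf.leadingCoeff, (orthoPoly_monic μ k).leadingCoeff])
  have := ip_orthoPoly_of_degree_lt hmom hsupp h
  rw [ip_sub_right hmom] at this
  linarith

theorem ip_X_mul (p q : ℝ[X]) : ip μ (X * p) q = ip μ p (X * q) := by
  simp only [ip, eval_mul, eval_X]
  congr 1
  ext x
  ring

theorem ip_orthoPoly_self_pos (hmom : ∀ n : ℕ, Integrable (fun x : ℝ => x ^ n) μ)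
    (hsupp : μ.support.Infinite) (k : ℕ) : 0 < ip μ (orthoPoly μ k) (orthoPoly μ k) :=
  lt_of_le_of_ne (integral_nonneg fun _ => mul_self_nonneg _)
    (ip_self_ne_zero hmom hsupp (orthoPoly_monic μ k).ne_zero).symm

theorem beta_pos (hmom : ∀ n : ℕ, Integrable (fun x : ℝ => x ^ n) μ)
    (hsupp : μ.support.Infinite) (k : ℕ) : 0 < beta μ k := by
  cases k with
  | zero => exact ip_orthoPoly_self_pos hmom hsupp 0
  | succ k => exact div_pos (ip_orthoPoly_self_pos hmom hsupp _) (ip_orthoPoly_self_pos hmom hsupp _)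

theorem orthoPoly_zero (μ : Measure ℝ) : orthoPoly μ 0 = 1 := by
  rw [orthoPoly]
  simp

theorem eq_zero_of_ip_orthoPoly (hmom : ∀ n : ℕ, Integrable (fun x : ℝ => x ^ n) μ)
    (hsupp : μ.support.Infinite) {n : ℕ} {r : ℝ[X]} (hr : r.degree < n)
    (h : ∀ i < n, ip μ (orthoPoly μ i) r = 0) : r = 0 := by
  by_contra h0
  refine ip_self_ne_zero hmom hsupp h0 ?_
  have := linearMap_eq_zero_of_monic (L := integralMap hmom ∘ₗ LinearMap.mulLeft ℝ r)
    (orthoPoly_monic μ) (natDegree_orthoPoly μ) (n := n) (fun d hd => by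
      have := h d hd
      rw [ip_comm, ip_eq_integralMap hmom] at this
      simpa using this) hr
  rw [ip_eq_integralMap hmom]
  simpa using this

theorem ip_C_mul_right (p q : ℝ[X]) (c : ℝ) : ip μ p (C c * q) = c * ip μ p q := by
  simp only [ip, eval_mul, eval_C]
  rw [← integral_const_mul]
  congr 1
  ext x
  ring

theorem degree_sub_lt_of_degree_lt {p q : ℝ[X]} {n : WithBot ℕ} (hp : p.degree < n)
    (hq : q.degree < n) : (p - q).degree < n :=
  (degree_sub_le p q).trans_lt (max_lt hp hq)

theorem degree_X_mul_orthoPoly_sub_lt (μ : Measure ℝ) (k : ℕ) :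
    (X * orthoPoly μ k - orthoPoly μ (k + 1)).degree < ((k + 1 : ℕ) : WithBot ℕ) := by
  have h : (X * orthoPoly μ k).degree = ((k + 1 : ℕ) : WithBot ℕ) := by
    rw [degree_mul, degree_X, degree_orthoPoly]
    push_cast
    ring
  rw [← h]
  exact degree_sub_lt_left (by rw [h, degree_orthoPoly])
    (monic_X.mul (orthoPoly_monic μ k)).ne_zero
    (by rw [(monic_X.mul (orthoPoly_monic μ k)).leadingCoeff,
      (orthoPoly_monic μ (k + 1)).leadingCoeff])

theorem degree_C_mul_orthoPoly_lt (μ : Measure ℝ) (c : ℝ) {k n : ℕ} (h : k < n) :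
    (C c * orthoPoly μ k).degree < n := by
  rw [← smul_eq_C_mul]
  refine (degree_smul_le _ _).trans_lt ?_
  rw [degree_orthoPoly]
  exact_mod_cast h

theorem orthoPoly_one (hmom : ∀ n : ℕ, Integrable (fun x : ℝ => x ^ n) μ)
    (hsupp : μ.support.Infinite) :
    X * orthoPoly μ 0 = orthoPoly μ 1 + C (alpha μ 0) * orthoPoly μ 0 := by
  rw [← sub_eq_iff_eq_add', ← sub_eq_zero]
  refine eq_zero_of_ip_orthoPoly hmom hsupp (n := 1)
    (degree_sub_lt_of_degree_lt (degree_X_mul_orthoPoly_sub_lt μ 0)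
      (degree_C_mul_orthoPoly_lt μ _ one_pos)) fun i hi => ?_
  obtain rfl : i = 0 := by omega
  have := (ip_orthoPoly_self_pos hmom hsupp 0).ne'
  rw [ip_sub_right hmom, ip_sub_right hmom, ip_C_mul_right,
    ip_orthoPoly_of_lt hmom hsupp 1 0 one_pos, alpha, ip_X_mul, div_mul_cancel₀ _ this]
  ring

/-- The three-term recurrence. -/
theorem orthoPoly_add_two (hmom : ∀ n : ℕ, Integrable (fun x : ℝ => x ^ n) μ)
    (hsupp : μ.support.Infinite) (k : ℕ) :
    X * orthoPoly μ (k + 1) = orthoPoly μ (k + 2) + C (alpha μ (k + 1)) * orthoPoly μ (k + 1) +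
      C (beta μ (k + 1)) * orthoPoly μ k := by
  rw [add_assoc, ← sub_eq_iff_eq_add', ← sub_eq_zero, ← sub_sub]
  refine eq_zero_of_ip_orthoPoly hmom hsupp (n := k + 2) ?_ fun i hi => ?_
  · exact degree_sub_lt_of_degree_lt (degree_sub_lt_of_degree_lt (degree_X_mul_orthoPoly_sub_lt μ (k + 1))
      (degree_C_mul_orthoPoly_lt μ _ (by omega))) (degree_C_mul_orthoPoly_lt μ _ (by omega))
  · have hk := (ip_orthoPoly_self_pos hmom hsupp k).ne'
    have hk1 := (ip_orthoPoly_self_pos hmom hsupp (k + 1)).ne'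
    have hX : ∀ j, (X * orthoPoly μ j).degree = ((j + 1 : ℕ) : WithBot ℕ) := fun j => by
      rw [degree_mul, degree_X, degree_orthoPoly]
      push_cast
      ring
    rw [ip_sub_right hmom, ip_sub_right hmom, ip_sub_right hmom, ip_C_mul_right, ip_C_mul_right,
      ip_orthoPoly_of_lt hmom hsupp (k + 2) i hi]
    rcases lt_trichotomy i k with h | rfl | h
    · rw [ip_orthoPoly_of_lt hmom hsupp (k + 1) i (by omega), ip_orthoPoly_of_lt hmom hsupp k i h,
        ← ip_X_mul, ip_comm, ip_orthoPoly_of_degree_lt hmom hsupp]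
      · ring
      · rw [hX]
        exact_mod_cast Nat.succ_lt_succ h
    · rw [ip_orthoPoly_of_lt hmom hsupp (i + 1) i (by omega), ← ip_X_mul, ip_comm,
        ip_orthoPoly_of_monic hmom hsupp (monic_X.mul (orthoPoly_monic μ i)) (hX i), beta,
        div_mul_cancel₀ _ hk]
      ring
    · obtain rfl : i = k + 1 := by omega
      rw [ip_comm μ (orthoPoly μ (k + 1)) (orthoPoly μ k),
        ip_orthoPoly_of_lt hmom hsupp (k + 1) k (by omega), ← ip_X_mul, alpha,
        div_mul_cancel₀ _ hk1]
      ring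

theorem offDiag_pos (hmom : ∀ n : ℕ, Integrable (fun x : ℝ => x ^ n) μ)
    (hsupp : μ.support.Infinite) (m i : ℕ) : 0 < offDiag μ m i := by
  have h := beta_pos hmom hsupp
  unfold offDiag
  split_ifs
  · exact Real.sqrt_pos.2 (add_pos (h _) (h _))
  · exact Real.sqrt_pos.2 (h _)

theorem offDiag_sq_of_ne (hmom : ∀ n : ℕ, Integrable (fun x : ℝ => x ^ n) μ)
    (hsupp : μ.support.Infinite) {m i : ℕ} (hi : i + 1 ≠ m) :
    offDiag μ m i ^ 2 = beta μ (i + 1) := by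
  rw [offDiag, if_neg hi, Real.sq_sqrt (beta_pos hmom hsupp _).le]

theorem beta_le_offDiag_sq (hmom : ∀ n : ℕ, Integrable (fun x : ℝ => x ^ n) μ)
    (hsupp : μ.support.Infinite) (m i : ℕ) : beta μ (i + 1) ≤ offDiag μ m i ^ 2 := by
  have h := beta_pos hmom hsupp
  by_cases hi : i + 1 = m
  · rw [offDiag, if_pos hi, Real.sq_sqrt (add_pos (h _) (h _)).le, hi]
    linarith [h (m + 1)]
  · exact (offDiag_sq_of_ne hmom hsupp hi).ge

/-- The product of the first `j` off-diagonal entries of `J*_{m+1}`. -/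
noncomputable def scale (μ : Measure ℝ) (m j : ℕ) : ℝ := ∏ i ∈ Finset.range j, offDiag μ m i

theorem scale_succ (μ : Measure ℝ) (m j : ℕ) :
    scale μ m (j + 1) = scale μ m j * offDiag μ m j := Finset.prod_range_succ _ _

theorem scale_pos (hmom : ∀ n : ℕ, Integrable (fun x : ℝ => x ^ n) μ)
    (hsupp : μ.support.Infinite) (m j : ℕ) : 0 < scale μ m j :=
  Finset.prod_pos fun i _ => offDiag_pos hmom hsupp m i

theorem ip_orthoPoly_succ_self (hmom : ∀ n : ℕ, Integrable (fun x : ℝ => x ^ n) μ)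
    (hsupp : μ.support.Infinite) (k : ℕ) :
    ip μ (orthoPoly μ (k + 1)) (orthoPoly μ (k + 1)) =
      beta μ (k + 1) * ip μ (orthoPoly μ k) (orthoPoly μ k) := by
  rw [beta, div_mul_cancel₀ _ (ip_orthoPoly_self_pos hmom hsupp k).ne']

theorem beta_zero_mul_scale_sq (hmom : ∀ n : ℕ, Integrable (fun x : ℝ => x ^ n) μ)
    (hsupp : μ.support.Infinite) {m j : ℕ} (hj : j < m) :
    beta μ 0 * scale μ m j ^ 2 = ip μ (orthoPoly μ j) (orthoPoly μ j) := by
  induction j with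
  | zero => simp [scale, beta]
  | succ j ih =>
    rw [scale_succ, mul_pow, ip_orthoPoly_succ_self hmom hsupp, ← ih (by omega),
      offDiag_sq_of_ne hmom hsupp hj.ne]
    ring

theorem ip_le_beta_zero_mul_scale_sq (hmom : ∀ n : ℕ, Integrable (fun x : ℝ => x ^ n) μ)
    (hsupp : μ.support.Infinite) (m j : ℕ) :
    ip μ (orthoPoly μ j) (orthoPoly μ j) ≤ beta μ 0 * scale μ m j ^ 2 := by
  induction j with
  | zero => simp [scale, beta]
  | succ j ih =>
    rw [scale_succ, mul_pow, ip_orthoPoly_succ_self hmom hsupp]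
    calc _ ≤ offDiag μ m j ^ 2 * (beta μ 0 * scale μ m j ^ 2) :=
          mul_le_mul (beta_le_offDiag_sq hmom hsupp m j) ih
            (ip_orthoPoly_self_pos hmom hsupp j).le (sq_nonneg _)
      _ = _ := by ring

theorem JStar_mulVec_zero (μ : Measure ℝ) {m : ℕ} (hm : 0 < m) (v : Fin (m + 1) → ℝ) :
    (JStar μ m).mulVec v 0 = alpha μ 0 * v 0 + offDiag μ m 0 * v ⟨1, by omega⟩ := by
  have hne : (0 : Fin (m + 1)) ≠ ⟨1, by omega⟩ := by simp [Fin.ext_iff]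
  rw [Matrix.mulVec, dotProduct, ← Finset.sum_subset (Finset.subset_univ {0, ⟨1, by omega⟩}),
    Finset.sum_pair hne]
  · simp [JStar, Fin.ext_iff]
  · intro l _ hl
    simp only [Finset.mem_insert, Finset.mem_singleton, Fin.ext_iff, not_or, Fin.val_zero] at hl
    have h : JStar μ m 0 l = 0 := by
      simp only [JStar, Matrix.of_apply, Fin.ext_iff]
      rw [if_neg (by simp; omega), if_neg (by simp; omega), if_neg (by simp)]
    rw [h, zero_mul]

theorem JStar_mulVec_succ (μ : Measure ℝ) {m j : ℕ} (hj : j + 2 < m + 1) (v : Fin (m + 1) → ℝ) :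
    (JStar μ m).mulVec v ⟨j + 1, by omega⟩ = offDiag μ m j * v ⟨j, by omega⟩ +
      (alpha μ (j + 1) * v ⟨j + 1, by omega⟩ + offDiag μ m (j + 1) * v ⟨j + 2, hj⟩) := by
  have h₁ : (⟨j, by omega⟩ : Fin (m + 1)) ∉
      ({⟨j + 1, by omega⟩, ⟨j + 2, hj⟩} : Finset (Fin (m + 1))) := by simp [Fin.ext_iff]
  have h₂ : (⟨j + 1, by omega⟩ : Fin (m + 1)) ≠ ⟨j + 2, hj⟩ := by simp [Fin.ext_iff]
  rw [Matrix.mulVec, dotProduct, ← Finset.sum_subset (Finset.subset_univ (insert ⟨j, by omega⟩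
    ({⟨j + 1, by omega⟩, ⟨j + 2, hj⟩} : Finset (Fin (m + 1))))), Finset.sum_insert h₁,
    Finset.sum_pair h₂]
  · simp [JStar, Fin.ext_iff, show j + 1 + 1 ≠ j by omega]
  · intro l _ hl
    simp only [Finset.mem_insert, Finset.mem_singleton, Fin.ext_iff, not_or] at hl
    have h : JStar μ m ⟨j + 1, by omega⟩ l = 0 := by
      simp only [JStar, Matrix.of_apply, Fin.ext_iff]
      rw [if_neg (by omega), if_neg (by omega), if_neg (by omega)]
    rw [h, zero_mul]

/-- The components of an eigenvector of `J*_{m+1}` are multiples of the values of the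
orthogonal polynomials at the eigenvalue. -/
theorem scale_mul_eigenvector (hmom : ∀ n : ℕ, Integrable (fun x : ℝ => x ^ n) μ)
    (hsupp : μ.support.Infinite) {m : ℕ} {v : Fin (m + 1) → ℝ} {x : ℝ}
    (hv : (JStar μ m).mulVec v = x • v) (j : ℕ) (hj : j < m + 1) :
    scale μ m j * v ⟨j, hj⟩ = v 0 * (orthoPoly μ j).eval x := by
  induction j using Nat.strong_induction_on with
  | _ j ih =>
    match j, ih, hj with
    | 0, _, _ => simp [scale, orthoPoly_zero]
    | 1, _, hj =>
      have h := congrFun hv 0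
      rw [JStar_mulVec_zero μ (by omega)] at h
      have hr := congrArg (eval x) (orthoPoly_one hmom hsupp)
      simp only [orthoPoly_zero, mul_one, eval_X, eval_add, eval_C] at hr
      simp only [Pi.smul_apply, smul_eq_mul] at h
      simp only [scale, Finset.prod_range_one]
      linear_combination h + v 0 * hr
    | j + 2, ih, hj =>
      have h := congrFun hv ⟨j + 1, by omega⟩
      rw [JStar_mulVec_succ μ hj] at h
      have hr := congrArg (eval x) (orthoPoly_add_two hmom hsupp j)
      simp only [eval_mul, eval_X, eval_add, eval_C] at hr
      simp only [Pi.smul_apply, smul_eq_mul] at h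
      have h0 := ih j (by omega) (by omega)
      have h1 := ih (j + 1) (by omega) (by omega)
      have hb := offDiag_sq_of_ne hmom hsupp (show j + 1 ≠ m by omega)
      rw [scale_succ] at h1
      rw [scale_succ, scale_succ]
      linear_combination scale μ m j * offDiag μ m j * h + v 0 * hr + (x - alpha μ (j + 1)) * h1 -
        offDiag μ m j ^ 2 * h0 - v 0 * (orthoPoly μ j).eval x * hb

theorem eigenvector_eq_zero (hmom : ∀ n : ℕ, Integrable (fun x : ℝ => x ^ n) μ)
    (hsupp : μ.support.Infinite) {m : ℕ} {v : Fin (m + 1) → ℝ} {x : ℝ}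
    (hv : (JStar μ m).mulVec v = x • v) (h0 : v 0 = 0) : v = 0 := by
  ext j
  have := scale_mul_eigenvector hmom hsupp hv j j.isLt
  rw [h0, zero_mul] at this
  exact (mul_eq_zero.1 this).resolve_left (scale_pos hmom hsupp m j).ne'

theorem eigenvalues_injective (hmom : ∀ n : ℕ, Integrable (fun x : ℝ => x ^ n) μ)
    (hsupp : μ.support.Infinite) (m : ℕ) :
    Function.Injective (JStar_isHermitian μ m).eigenvalues := by
  intro i j hij
  by_contra hne
  set b := (JStar_isHermitian μ m).eigenvectorBasis with hb
  have hi := (JStar_isHermitian μ m).mulVec_eigenvectorBasis i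
  have hj := (JStar_isHermitian μ m).mulVec_eigenvectorBasis j
  rw [← hij] at hj
  rw [← hb] at hi hj
  have hw : (JStar μ m).mulVec (b i 0 • ⇑(b j) - b j 0 • ⇑(b i)) =
      (JStar_isHermitian μ m).eigenvalues i • (b i 0 • ⇑(b j) - b j 0 • ⇑(b i)) := by
    rw [Matrix.mulVec_sub, Matrix.mulVec_smul, Matrix.mulVec_smul, hi, hj, smul_sub,
      smul_comm, smul_comm (b j 0)]
  have hz := eigenvector_eq_zero hmom hsupp hw (by simp [mul_comm])
  have hz' : b i 0 • b j = b j 0 • b i := by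
    ext l
    simpa [sub_eq_zero] using congrFun hz l
  have hin := congrArg (fun y => inner ℝ (b j) y) hz'
  simp only [inner_smul_right, b.inner_eq_ite, if_true, if_neg (Ne.symm hne)] at hin
  have h0 : b i 0 = 0 := by simpa using hin
  have hbi : b i = 0 := by
    ext l
    exact congrFun (eigenvector_eq_zero hmom hsupp hi h0) l
  exact b.orthonormal.ne_zero i hbi

theorem node_strictMono (hmom : ∀ n : ℕ, Integrable (fun x : ℝ => x ^ n) μ)
    (hsupp : μ.support.Infinite) (m : ℕ) : StrictMono (node μ m) :=
  (Tuple.monotone_sort _).strictMono_of_injective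
    ((eigenvalues_injective hmom hsupp m).comp (order μ m).injective)

/-- The quadrature rule `G*_{m+1}` as a linear functional on polynomials. -/
noncomputable def quadMap (μ : Measure ℝ) (m : ℕ) : ℝ[X] →ₗ[ℝ] ℝ where
  toFun f := ∑ i, weight μ m i * f.eval (node μ m i)
  map_add' f g := by simp [mul_add, Finset.sum_add_distrib]
  map_smul' c f := by
    simp only [eval_smul, smul_eq_mul, RingHom.id_apply, Finset.mul_sum]
    exact Finset.sum_congr rfl fun i _ => by ring

theorem quadMap_apply (m : ℕ) (f : ℝ[X]) :
    quadMap μ m f = ∑ i, weight μ m i * f.eval (node μ m i) := rfl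

theorem quadMap_orthoPoly_mul (hmom : ∀ n : ℕ, Integrable (fun x : ℝ => x ^ n) μ)
    (hsupp : μ.support.Infinite) {m j l : ℕ} (hj : j < m + 1) (hl : l < m + 1) :
    quadMap μ m (orthoPoly μ j * orthoPoly μ l) =
      if j = l then beta μ 0 * scale μ m j ^ 2 else 0 := by
  set b := (JStar_isHermitian μ m).eigenvectorBasis with hb
  have horth : ∑ i, b i ⟨j, hj⟩ * b i ⟨l, hl⟩ = if j = l then 1 else 0 := by
    have := b.sum_inner_mul_inner (EuclideanSpace.single ⟨j, hj⟩ 1)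
      (EuclideanSpace.single ⟨l, hl⟩ 1)
    simpa [EuclideanSpace.inner_single_left, EuclideanSpace.inner_single_right, Fin.ext_iff,
      eq_comm] using this
  have hterm : ∀ i, beta μ 0 * b i 0 ^ 2 *
      (orthoPoly μ j * orthoPoly μ l).eval ((JStar_isHermitian μ m).eigenvalues i) =
      beta μ 0 * scale μ m j * scale μ m l * (b i ⟨j, hj⟩ * b i ⟨l, hl⟩) := by
    intro i
    have hi := (JStar_isHermitian μ m).mulVec_eigenvectorBasis i
    have h₁ := scale_mul_eigenvector hmom hsupp hi j hj
    have h₂ := scale_mul_eigenvector hmom hsupp hi l hl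
    rw [← hb] at h₁ h₂
    rw [eval_mul]
    calc _ = beta μ 0 * (b i 0 * (orthoPoly μ j).eval ((JStar_isHermitian μ m).eigenvalues i)) *
          (b i 0 * (orthoPoly μ l).eval ((JStar_isHermitian μ m).eigenvalues i)) := by ring
      _ = _ := by
        rw [← h₁, ← h₂]
        ring
  rw [quadMap_apply]
  simp only [weight, node, ← hb]
  rw [Equiv.sum_comp (order μ m) fun i => beta μ 0 * b i 0 ^ 2 *
    (orthoPoly μ j * orthoPoly μ l).eval ((JStar_isHermitian μ m).eigenvalues i)]
  simp only [hterm, ← Finset.mul_sum, horth]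
  split_ifs with h
  · subst h
    ring
  · ring

theorem sum_weight (hmom : ∀ n : ℕ, Integrable (fun x : ℝ => x ^ n) μ)
    (hsupp : μ.support.Infinite) (m : ℕ) : ∑ i, weight μ m i = μ.real Set.univ := by
  have := quadMap_orthoPoly_mul hmom hsupp m.succ_pos m.succ_pos
  simpa [quadMap_apply, orthoPoly_zero, scale, beta, ip] using this

theorem integralMap_eq_quadMap (hmom : ∀ n : ℕ, Integrable (fun x : ℝ => x ^ n) μ)
    (hsupp : μ.support.Infinite) {m : ℕ} {f : ℝ[X]} (hf : f.degree < (2 * m : ℕ)) :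
    integralMap hmom f = quadMap μ m f := by
  rw [← sub_eq_zero, ← LinearMap.sub_apply]
  refine linearMap_eq_zero_of_monic (e := fun d => orthoPoly μ (d / 2) * orthoPoly μ (d - d / 2))
    (fun d => (orthoPoly_monic μ _).mul (orthoPoly_monic μ _)) (fun d => ?_) (fun d hd => ?_) hf
  · rw [(orthoPoly_monic μ _).natDegree_mul (orthoPoly_monic μ _), natDegree_orthoPoly,
      natDegree_orthoPoly]
    omega
  · rw [LinearMap.sub_apply, ← ip_eq_integralMap,
      quadMap_orthoPoly_mul hmom hsupp (by omega) (by omega)]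
    split_ifs with h
    · rw [← h, beta_zero_mul_scale_sq hmom hsupp (by omega), sub_self]
    · rw [ip_orthoPoly_of_lt hmom hsupp _ _ (by omega), sub_self]

theorem integralMap_le_quadMap (hmom : ∀ n : ℕ, Integrable (fun x : ℝ => x ^ n) μ)
    (hsupp : μ.support.Infinite) {m : ℕ} {f : ℝ[X]} (hf : f.natDegree ≤ 2 * m)
    (hc : 0 ≤ f.coeff (2 * m)) : integralMap hmom f ≤ quadMap μ m f := by
  set e := orthoPoly μ m * orthoPoly μ m with he
  have hem : e.Monic := (orthoPoly_monic μ m).mul (orthoPoly_monic μ m)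
  have hed : e.natDegree = 2 * m := by
    rw [he, (orthoPoly_monic μ m).natDegree_mul (orthoPoly_monic μ m), natDegree_orthoPoly]
    ring
  have hlt : (f - f.coeff (2 * m) • e).degree < (2 * m : ℕ) := by
    rw [degree_lt_iff_coeff_zero]
    intro i hi
    rcases hi.eq_or_lt with rfl | hi
    · have := hem.coeff_natDegree
      rw [hed] at this
      simp [this]
    · simp [coeff_eq_zero_of_natDegree_lt (hf.trans_lt hi),
        coeff_eq_zero_of_natDegree_lt (hed.trans_lt hi)]
  have h := integralMap_eq_quadMap hmom hsupp hlt
  rw [map_sub, map_sub, map_smul, map_smul, smul_eq_mul, smul_eq_mul] at h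
  have hle : integralMap hmom e ≤ quadMap μ m e := by
    rw [← ip_eq_integralMap, quadMap_orthoPoly_mul hmom hsupp m.lt_succ_self m.lt_succ_self,
      if_pos rfl]
    exact ip_le_beta_zero_mul_scale_sq hmom hsupp m m
  have := mul_le_mul_of_nonneg_left hle hc
  linarith

theorem coeff_nonneg_of_eval_nonneg {f : ℝ[X]} (h : ∀ x, 0 ≤ f.eval x) {n : ℕ}
    (hn : f.natDegree ≤ n) : 0 ≤ f.coeff n := by
  rcases hn.eq_or_lt with rfl | hn
  · by_contra! hlt
    rcases Nat.eq_zero_or_pos f.natDegree with h0 | hpos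
    · have := h 0
      rw [← coeff_zero_eq_eval_zero, ← h0] at this
      linarith
    · have := (f.tendsto_atBot_of_leadingCoeff_nonpos
        (natDegree_pos_iff_degree_pos.1 hpos) hlt.le).eventually_lt_atBot 0
      obtain ⟨x, hx⟩ := this.exists
      exact (h x).not_gt hx
  · rw [coeff_eq_zero_of_natDegree_lt hn]

theorem isFiniteMeasure_of_moments (hmom : ∀ n : ℕ, Integrable (fun x : ℝ => x ^ n) μ) :
    IsFiniteMeasure μ := by
  have := hmom 0
  simp only [pow_zero] at this
  exact (integrable_const_iff_isFiniteMeasure one_ne_zero).1 this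

/-- A nonnegative polynomial of degree at most `2m` that majorizes the indicator function of a
set bounds the measure of the set through the quadrature rule. -/
theorem measureReal_le_sum_weight (hmom : ∀ n : ℕ, Integrable (fun x : ℝ => x ^ n) μ)
    (hsupp : μ.support.Infinite) {m : ℕ} {f : ℝ[X]} (hf : f.natDegree ≤ 2 * m)
    (h0 : ∀ x, 0 ≤ f.eval x) {s : Set ℝ} (hs : MeasurableSet s) (h1 : ∀ x ∈ s, 1 ≤ f.eval x)
    {t : Finset (Fin (m + 1))} (ht : ∀ i ∈ t, f.eval (node μ m i) = 1)
    (ht' : ∀ i ∉ t, f.eval (node μ m i) = 0) : μ.real s ≤ ∑ i ∈ t, weight μ m i := by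
  have := isFiniteMeasure_of_moments hmom
  calc μ.real s = ∫ x, s.indicator 1 x ∂μ := (integral_indicator_one hs).symm
    _ ≤ integralMap hmom f := by
      refine integral_mono ((integrable_const (1 : ℝ)).indicator hs) (integrable_eval hmom f)
        fun x => ?_
      exact Set.indicator_apply_le' (fun hx => h1 x hx) fun _ => h0 x
    _ ≤ quadMap μ m f := integralMap_le_quadMap hmom hsupp hf (coeff_nonneg_of_eval_nonneg h0 hf)
    _ = ∑ i ∈ t, weight μ m i := by
      rw [quadMap_apply, ← Finset.sum_subset (Finset.subset_univ t)]
      · exact Finset.sum_congr rfl fun i hi => by rw [ht i hi, mul_one]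
      · intro i _ hi
        rw [ht' i hi, mul_zero]

theorem card_Iio_add_card_Ioi {m : ℕ} (k : Fin (m + 1)) :
    (Finset.Iio k).card + (Finset.Ioi k).card = m := by
  rw [Fin.card_Iio, Fin.card_Ioi]
  omega

theorem measureReal_Iic_node_le (hmom : ∀ n : ℕ, Integrable (fun x : ℝ => x ^ n) μ)
    (hsupp : μ.support.Infinite) (m : ℕ) (k : Fin (m + 1)) :
    μ.real (Set.Iic (node μ m k)) ≤ ∑ i ∈ Finset.Iic k, weight μ m i := by
  have hmono := node_strictMono hmom hsupp m
  obtain ⟨f, hf, h0, h1, hs, hb, ht⟩ := exists_majorant (b := node μ m k)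
    ((Finset.Iio k).image (node μ m)) ((Finset.Ioi k).image (node μ m))
    (by simpa using fun i hi => hmono hi) (by simpa using fun i hi => hmono hi)
  rw [Finset.card_image_of_injective _ hmono.injective,
    Finset.card_image_of_injective _ hmono.injective, card_Iio_add_card_Ioi] at hf
  refine measureReal_le_sum_weight hmom hsupp hf h0 measurableSet_Iic h1 (fun i hi => ?_)
    fun i hi => ht _ (Finset.mem_image_of_mem _ (by simpa using hi))
  rcases (Finset.mem_Iic.1 hi).eq_or_lt with rfl | hi
  · exact hb
  · exact hs _ (Finset.mem_image_of_mem _ (Finset.mem_Iio.2 hi))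

theorem measureReal_Ici_node_le (hmom : ∀ n : ℕ, Integrable (fun x : ℝ => x ^ n) μ)
    (hsupp : μ.support.Infinite) (m : ℕ) (k : Fin (m + 1)) :
    μ.real (Set.Ici (node μ m k)) ≤ ∑ i ∈ Finset.Ici k, weight μ m i := by
  have hmono := node_strictMono hmom hsupp m
  have hinj : Function.Injective fun i => -node μ m i := neg_injective.comp hmono.injective
  obtain ⟨f, hf, h0, h1, hs, hb, ht⟩ := exists_majorant (b := -node μ m k)
    ((Finset.Ioi k).image fun i => -node μ m i) ((Finset.Iio k).image fun i => -node μ m i)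
    (by simpa using fun i hi => hmono hi) (by simpa using fun i hi => hmono hi)
  rw [Finset.card_image_of_injective _ hinj, Finset.card_image_of_injective _ hinj, add_comm,
    card_Iio_add_card_Ioi] at hf
  have hev : ∀ x, (f.comp (-X)).eval x = f.eval (-x) := fun x => by simp
  refine measureReal_le_sum_weight (f := f.comp (-X)) hmom hsupp ?_
    (fun x => by rw [hev]; exact h0 _) measurableSet_Ici
    (fun x hx => by rw [hev]; exact h1 _ (neg_le_neg hx)) (fun i hi => ?_) fun i hi => ?_
  · rw [natDegree_comp]
    simpa using hf
  · rw [hev]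
    rcases (Finset.mem_Ici.1 hi).eq_or_lt with rfl | hi
    · exact hb
    · exact hs _ (Finset.mem_image_of_mem (fun i => -node μ m i) (Finset.mem_Ioi.2 hi))
  · rw [hev]
    exact ht _ (Finset.mem_image_of_mem (fun i => -node μ m i) (by simpa using hi))

theorem sum_weight_Iio_le (hmom : ∀ n : ℕ, Integrable (fun x : ℝ => x ^ n) μ)
    (hsupp : μ.support.Infinite) (m : ℕ) (k : Fin (m + 1)) :
    ∑ i ∈ Finset.Iio k, weight μ m i ≤ μ.real (Set.Iio (node μ m k)) := by
  have := isFiniteMeasure_of_moments hmom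
  have h₁ := measureReal_add_measureReal_compl (μ := μ) (measurableSet_Iio (a := node μ m k))
  have h₂ := Finset.sum_add_sum_compl (Finset.Iio k) (weight μ m)
  have hc : (Finset.Iio k)ᶜ = Finset.Ici k := by
    ext i
    simp
  rw [Set.compl_Iio] at h₁
  rw [hc, sum_weight hmom hsupp] at h₂
  linarith [measureReal_Ici_node_le hmom hsupp m k]

end AveragedGauss

theorem lemma2p1 (μ : MeasureTheory.Measure ℝ)
    (hmom : ∀ n : ℕ, MeasureTheory.Integrable (fun x : ℝ => x ^ n) μ)
    (hsupp : μ.support.Infinite) (m : ℕ) (k : Fin (m + 1)) :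
    ∑ i ∈ Finset.Iio k, AveragedGauss.weight μ m i
        ≤ μ.real (Set.Iic (AveragedGauss.node μ m k)) ∧
      μ.real (Set.Iic (AveragedGauss.node μ m k))
        ≤ ∑ i ∈ Finset.Iic k, AveragedGauss.weight μ m i := by
  have := AveragedGauss.isFiniteMeasure_of_moments hmom
  exact ⟨(AveragedGauss.sum_weight_Iio_le hmom hsupp m k).trans
    (MeasureTheory.measureReal_mono Set.Iio_subset_Iic_self),
    AveragedGauss.measureReal_Iic_node_le hmom hsupp m k⟩
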